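/- For $f:\{0,1\}^n\to\{-1,1\}$ let $\mathcal{D}_f$ be the probability distribution on $\{0,1\}^n$ given by $$\Pr_{\mathcal{D}_f}[y]=\Bigl(2^{-n}\sum_{x\in\{0,1\}^n} f(x)(-1)^{x\cdot y}\Bigr)^2 .$$ A randomized algorithm making at most $t$ queries is a probability distribution over decision trees of depth at most $t$ that adaptively query values of $f$ and output a string in $\{0,1\}^n$. It solves Fourier Sampling with error at most $\varepsilon$ if for every $f:\{0,1\}^n\to\{-1,1\}$ the distribution of its output on oracle $f$ is within total variation distance $\varepsilon$ of $\mathcal{D}_f$, where the total variation distance is $\|\mathcal{D}-\mathcal{D}'\|=\frac12\sum_y|\mathcal{D}(y)-\mathcal{D}'(y)|$. Let $\varepsilon=1/40000$. (1) Any randomized algorithm solving Fourier Sampling with error at most $\varepsilon$ needs $\Omega(2^n)$ queries: there are $c>0$ and $n_0$ such that for all $n\ge n_0$, every randomized algorithm that solves Fourier Sampling on $\{0,1\}^n$ with error at most $\varepsilon$ makes at least $c\,2^n$ queries. (2) For every $n$ there is a quantum algorithm making exactly one query that, for every $f:\{0,1\}^n\to\{-1,1\}$, outputs a sample distributed exactly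 according to $\mathcal{D}_f$. (The unitaries of the algorithm do not depend on $f$, and a query is the controlled phase query $|x,b,w\rangle\mapsto f(x)^b|x,b,w\rangle$.) Together with (1) this is a 1 versus linear separation. (3) In particular, the lower bound $\Omega(2^n/n)$ is not tight: for every constant $C$ there is an $n_0$ such that for all $n\ge n_0$ no randomized algorithm making at most $C\,2^n/n$ queries solves Fourier Sampling on $\{0,1\}^n$ with error at most $\varepsilon$. This refutes the conjecture of Aaronson and Ambainis that the $\Omega(2^n/n)$ bound is tight. -/

import Mathlib

/-- The Boolean cube `{0,1}ⁿ`. -/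
abbrev Cube (n : ℕ) : Type := Fin n → Bool

/-- The character `(-1)^(x · z)`, where `x · z = ∑ i, x i * z i`. -/
def cubeChar {n : ℕ} (x z : Cube n) : ℝ := (-1) ^ (∑ i, (x i && z i).toNat)

/-- The probability `(2⁻ⁿ ∑ x, f x (-1)^(x · y))²`. The set `{-1,1}` is the type `ℤˣ`. -/
noncomputable def fourierWeight {n : ℕ} (f : Cube n → ℤˣ) (y : Cube n) : ℝ :=
  ((∑ x, ((f x : ℤ) : ℝ) * cubeChar x y) / 2 ^ n) ^ 2

theorem fourierWeight_nonneg {n : ℕ} (f : Cube n → ℤˣ) (y : Cube n) : 0 ≤ fourierWeight f y :=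
  sq_nonneg _

theorem sum_cubeChar_mul_cubeChar {n : ℕ} (x x' : Cube n) :
    ∑ y, cubeChar x y * cubeChar x' y = if x = x' then (2 : ℝ) ^ n else 0 := by
  have h1 : ∀ y : Cube n, cubeChar x y * cubeChar x' y =
      ∏ i, ((-1 : ℝ) ^ ((x i && y i).toNat) * (-1) ^ ((x' i && y i).toNat)) := by
    intro y
    rw [Finset.prod_mul_distrib, Finset.prod_pow_eq_pow_sum, Finset.prod_pow_eq_pow_sum]
    rfl
  have h2 := (Finset.prod_univ_sum (fun _ : Fin n => (Finset.univ : Finset Bool))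
    (fun i b => ((-1 : ℝ) ^ ((x i && b).toNat) * (-1) ^ ((x' i && b).toNat))))
  rw [Fintype.piFinset_univ] at h2
  rw [Finset.sum_congr rfl (fun y _ => h1 y), ← h2]
  split_ifs with h
  · subst h
    rw [Finset.prod_congr rfl (g := fun _ => (2 : ℝ))]
    · simp
    · intro i _
      cases x i <;> norm_num
  · obtain ⟨i, hi⟩ := Function.ne_iff.mp h
    apply Finset.prod_eq_zero (Finset.mem_univ i)
    revert hi
    cases x i <;> cases x' i <;> norm_num

theorem sum_fourierWeight {n : ℕ} (f : Cube n → ℤˣ) : ∑ y, fourierWeight f y = 1 := by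
  have hf : ∀ x, ((f x : ℤ) : ℝ) * ((f x : ℤ) : ℝ) = 1 := by
    intro x
    rcases Int.units_eq_one_or (f x) with h | h <;> simp [h]
  have h1 : ∀ y, fourierWeight f y = (∑ x, ∑ x', ((f x : ℤ) : ℝ) * ((f x' : ℤ) : ℝ) *
      (cubeChar x y * cubeChar x' y)) / (2 ^ n * 2 ^ n) := by
    intro y
    rw [fourierWeight, div_pow, sq, sq, Finset.sum_mul_sum]
    congr 1
    refine Finset.sum_congr rfl fun x _ => Finset.sum_congr rfl fun x' _ => ?_
    ring
  rw [Finset.sum_congr rfl (fun y _ => h1 y), ← Finset.sum_div, Finset.sum_comm]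
  have h2 : ∀ x, ∑ y, ∑ x', ((f x : ℤ) : ℝ) * ((f x' : ℤ) : ℝ) *
      (cubeChar x y * cubeChar x' y) = 2 ^ n := by
    intro x
    rw [Finset.sum_comm]
    simp_rw [← Finset.mul_sum, sum_cubeChar_mul_cubeChar]
    simp [hf]
  rw [Finset.sum_congr rfl (fun x _ => h2 x)]
  simp

/-- The distribution `𝒟_f` on `{0,1}ⁿ` that Fourier Sampling asks to sample from. -/
noncomputable def fourierDist {n : ℕ} (f : Cube n → ℤˣ) : PMF (Cube n) :=
  PMF.ofFintype (fun y => ENNReal.ofReal (fourierWeight f y)) (by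
    rw [← ENNReal.ofReal_sum_of_nonneg (fun y _ => fourierWeight_nonneg f y), sum_fourierWeight,
      ENNReal.ofReal_one])

/-- Total variation distance of two distributions on a finite type. -/
noncomputable def variationDist {α : Type} [Fintype α] (p q : PMF α) : ℝ :=
  (1 / 2) * ∑ y, |(p y).toReal - (q y).toReal|

/-- Deterministic adaptive query algorithms (decision trees) with oracle access to a function
`f : {0,1}ⁿ → {-1,1}` and output in `{0,1}ⁿ`: either stop with an output, or query `f` at `x`
and continue according to the answer. -/
inductive DecisionTree (n : ℕ) : Type
  | output (y : Cube n) : DecisionTree n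
  | query (x : Cube n) (next : ℤˣ → DecisionTree n) : DecisionTree n

/-- The output of a decision tree on the oracle `f`. -/
def DecisionTree.run {n : ℕ} (f : Cube n → ℤˣ) : DecisionTree n → Cube n
  | .output y => y
  | .query x next => (next (f x)).run f

/-- The largest number of queries on a branch of a decision tree. -/
def DecisionTree.depth {n : ℕ} : DecisionTree n → ℕ
  | .output _ => 0
  | .query _ next => max (next 1).depth (next (-1)).depth + 1

/-- A randomized query algorithm: a probability distribution over decision trees, each of which
makes at most `queries` queries. -/
structure RandomizedQueryAlgorithm (n : ℕ) where
  queries : ℕ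
  dist : PMF (DecisionTree n)
  depth_le : ∀ T ∈ dist.support, T.depth ≤ queries

/-- The distribution of the output of a randomized query algorithm on the oracle `f`. -/
noncomputable def RandomizedQueryAlgorithm.outputDist {n : ℕ} (A : RandomizedQueryAlgorithm n)
    (f : Cube n → ℤˣ) : PMF (Cube n) :=
  A.dist.map (DecisionTree.run f)

/-- The algorithm solves Fourier Sampling with error at most `ε`, on every oracle `f`. -/
def RandomizedQueryAlgorithm.SolvesFourierSampling {n : ℕ} (A : RandomizedQueryAlgorithm n)
    (ε : ℝ) : Prop :=
  ∀ f : Cube n → ℤˣ, variationDist (A.outputDist f) (fourierDist f) ≤ ε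

/-- Computational basis of a quantum query algorithm: `n` qubits that hold the query point,
a control qubit, and `m` qubits of workspace. -/
abbrev QueryBasis (n m : ℕ) : Type := Cube n × Bool × Cube m

/-- The (controlled) quantum query to `f`: `|x, b, w⟩ ↦ f(x)^b |x, b, w⟩`. -/
def quantumQuery {n m : ℕ} (f : Cube n → ℤˣ) (ψ : QueryBasis n m → ℂ) : QueryBasis n m → ℂ :=
  fun s => (if s.2.1 then ((f s.1 : ℤ) : ℂ) else 1) * ψ s

/-- A quantum query algorithm: start in `|0⋯0⟩`, apply `U 0`, then alternately make a query and
apply `U 1, …, U queries` (later entries of `U` play no role); finally measure all qubits and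
apply `out` to the outcome. The unitaries do not depend on `f`. -/
structure QuantumQueryAlgorithm (n : ℕ) where
  queries : ℕ
  workspace : ℕ
  U : ℕ → Matrix.unitaryGroup (QueryBasis n workspace) ℂ
  out : QueryBasis n workspace → Cube n

/-- The state after `j` queries, each followed by its unitary. -/
noncomputable def QuantumQueryAlgorithm.state {n : ℕ} (Q : QuantumQueryAlgorithm n)
    (f : Cube n → ℤˣ) : ℕ → QueryBasis n Q.workspace → ℂ
  | 0 => (Q.U 0).1.mulVec
      (Pi.single ((fun _ => false, false, fun _ => false) : QueryBasis n Q.workspace) 1)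
  | j + 1 => (Q.U (j + 1)).1.mulVec (quantumQuery f (Q.state f j))

/-- The probability that the quantum algorithm outputs `y` on the oracle `f`. -/
noncomputable def QuantumQueryAlgorithm.outputProb {n : ℕ} (Q : QuantumQueryAlgorithm n)
    (f : Cube n → ℤˣ) (y : Cube n) : ℝ :=
  ∑ s, if Q.out s = y then ‖Q.state f Q.queries s‖ ^ 2 else 0

/-! Let N = 2 ^ n and S = `charSum f z`. The lower bound tests a sample z with cos (θ S), averaged
over uniform f. Exact sampling weights z by S² / N², so the test is biased: differentiating the
average of cos (θ S), which is cos θ ^ N, twice in θ gives mean cos θ ^ N - (N - 1) cos θ ^ (N - 2)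
sin θ ^ 2 (`sum_fourierWeight_mul_cos`), which is negative when θ² is about 4 / N. A tree of depth t
cannot imitate this. At a leaf, z is fixed and at least N - t values of f are still free and
independent; each contracts the mean of exp (i θ S) by cos θ, so the test has mean at least -cos θ ^
(N - t) (`DecisionTree.norm_sum_run_le`). Error ε changes the mean by at most 2 ε, which yields
`cos_bound`; at cos θ = 1 - 2 / N this forces t ≥ N / 10. The quantum algorithm is phase query
between two Hadamard layers: its final amplitudes are the numbers S / N. -/

/-! ### Decision trees and products of independent phases -/

section DecisionTreeBound

/-- The functions in a box that lead a decision tree to the output `z` after a first query at `x`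
are split by the answer to that query. -/
theorem DecisionTree.sum_run_query {n : ℕ} {M : Type*} [AddCommMonoid M] (x z : Cube n)
    (next : ℤˣ → DecisionTree n) (s : Cube n → Finset ℤˣ) (F : (Cube n → ℤˣ) → M) :
    ∑ f ∈ Fintype.piFinset s with (DecisionTree.query x next).run f = z, F f =
      ∑ v, ∑ f ∈ Fintype.piFinset (Function.update s x (s x ∩ {v})) with (next v).run f = z,
        F f := by
  rw [← Finset.sum_fiberwise _ (fun f : Cube n → ℤˣ => f x)]
  refine Finset.sum_congr rfl fun v _ => Finset.sum_congr ?_ fun _ _ => rfl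
  ext f
  simp only [Finset.mem_filter, Fintype.mem_piFinset]
  simp only [DecisionTree.run]
  constructor
  · rintro ⟨⟨h1, h2⟩, rfl⟩
    refine ⟨fun a => ?_, h2⟩
    rcases eq_or_ne a x with rfl | ha
    · simp [h1]
    · simpa [Function.update_of_ne ha] using h1 a
  · rintro ⟨h1, h2⟩
    have hx : f x ∈ s x ∧ f x = v := by simpa using h1 x
    obtain ⟨hx, rfl⟩ := hx
    refine ⟨⟨fun a => ?_, h2⟩, rfl⟩
    rcases eq_or_ne a x with rfl | ha
    · exact hx
    · simpa [Function.update_of_ne ha] using h1 a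

theorem DecisionTree.depth_next_lt {n : ℕ} (x : Cube n) (next : ℤˣ → DecisionTree n) (v : ℤˣ) :
    (next v).depth + 1 ≤ (DecisionTree.query x next).depth := by
  rcases Int.units_eq_one_or v with rfl | rfl <;> simp [DecisionTree.depth]

/-- Restricting the value at one point of a box loses at most one free coordinate. -/
theorem card_free_le_update {ι : Type*} [Fintype ι] [DecidableEq ι] (s : ι → Finset ℤˣ) (x : ι)
    (r : Finset ℤˣ) :
    Finset.card {a | s a = Finset.univ} ≤
      Finset.card {a | Function.update s x r a = Finset.univ} + 1 := by
  refine le_trans (Finset.card_le_card (t := insert x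
    (Finset.univ.filter fun a => Function.update s x r a = Finset.univ)) fun a ha => ?_)
    (Finset.card_insert_le _ _)
  rcases eq_or_ne a x with rfl | h
  · simp
  · rw [Finset.mem_filter_univ] at ha
    rw [Finset.mem_insert, Finset.mem_filter_univ, Function.update_of_ne h]
    exact Or.inr ha

/-- If every free coordinate contracts the weight by `c`, then so does every coordinate that a
decision tree leaves unqueried. -/
theorem DecisionTree.norm_sum_run_le {n : ℕ} {w : Cube n → ℤˣ → ℂ} {c : ℝ} (hc0 : 0 ≤ c)
    (hc1 : c ≤ 1) (hw : ∀ x v, ‖w x v‖ ≤ 1) (hwc : ∀ x, ‖∑ v, w x v‖ ≤ 2 * c) (z : Cube n)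
    (T : DecisionTree n) (s : Cube n → Finset ℤˣ) :
    ‖∑ f ∈ Fintype.piFinset s with T.run f = z, ∏ x, w x (f x)‖ ≤
      c ^ (Finset.card {x | s x = Finset.univ} - T.depth) *
        ∑ f ∈ Fintype.piFinset s with T.run f = z, (1 : ℝ) := by
  induction T generalizing s with
  | output y =>
    by_cases hy : y = z
    · simp only [DecisionTree.run, hy, Finset.filter_true, DecisionTree.depth, Nat.sub_zero]
      -- At a leaf the sum over the box factors over coordinates: a free one gives at most 2 * c,
      -- any other at most its number of allowed values.
      rw [← Finset.prod_univ_sum, norm_prod, Finset.sum_const, Fintype.card_piFinset,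
        nsmul_eq_mul, mul_one, Nat.cast_prod, ← Finset.prod_const, Finset.prod_filter,
        ← Finset.prod_mul_distrib]
      refine Finset.prod_le_prod (fun _ _ => norm_nonneg _) fun x _ => ?_
      split_ifs with h
      · rw [h]
        refine (hwc x).trans (le_of_eq ?_)
        simp [mul_comm]
      · refine (norm_sum_le _ _).trans ((Finset.sum_le_sum fun v _ => hw x v).trans ?_)
        simp
    · simp [DecisionTree.run, hy]
  | query x next ih =>
    rw [DecisionTree.sum_run_query, DecisionTree.sum_run_query, Finset.mul_sum]
    refine (norm_sum_le _ _).trans (Finset.sum_le_sum fun v _ => (ih v _).trans ?_)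
    -- A query uses up one unit of depth and at most one free coordinate, so the exponent does not
    -- drop.
    refine mul_le_mul_of_nonneg_right (pow_le_pow_of_le_one hc0 hc1 ?_)
      (Finset.sum_nonneg fun _ _ => zero_le_one)
    have h1 := DecisionTree.depth_next_lt x next v
    have h2 := card_free_le_update s x (s x ∩ {v})
    omega

end DecisionTreeBound

/-! ### Trigonometric moments of Fourier coefficients of a random function -/

section CharacterSums

/-- The unnormalised Fourier coefficient `∑ x, f x (-1)^(x · z)`. -/
def charSum {n : ℕ} (f : Cube n → ℤˣ) (z : Cube n) : ℝ := ∑ x, ((f x : ℤ) : ℝ) * cubeChar x z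

theorem cubeChar_eq_one_or {n : ℕ} (x z : Cube n) : cubeChar x z = 1 ∨ cubeChar x z = -1 :=
  neg_one_pow_eq_or ℝ _

theorem cubeChar_comm {n : ℕ} (x z : Cube n) : cubeChar x z = cubeChar z x := by
  simp only [cubeChar, Bool.and_comm]

theorem fourierWeight_eq_charSum {n : ℕ} (f : Cube n → ℤˣ) (z : Cube n) :
    fourierWeight f z = charSum f z ^ 2 / (2 ^ n) ^ 2 :=
  div_pow _ _ _

/-- The factor at `x` of `exp (i θ charSum f z)`. -/
noncomputable def phase {n : ℕ} (θ : ℝ) (z x : Cube n) (v : ℤˣ) : ℂ :=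
  Complex.exp ((θ * (((v : ℤ) : ℝ) * cubeChar x z) : ℝ) * Complex.I)

theorem norm_phase {n : ℕ} (θ : ℝ) (z x : Cube n) (v : ℤˣ) : ‖phase θ z x v‖ = 1 :=
  Complex.norm_exp_ofReal_mul_I _

theorem sum_phase {n : ℕ} (θ : ℝ) (z x : Cube n) :
    ∑ v, phase θ z x v = 2 * (Real.cos θ : ℂ) := by
  have h : (Finset.univ : Finset ℤˣ) = {1, -1} := rfl
  rw [h, Finset.sum_pair (by decide), Complex.ofReal_cos, Complex.two_cos]
  rcases cubeChar_eq_one_or x z with hx | hx <;> simp [phase, hx, add_comm]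

theorem prod_phase {n : ℕ} (θ : ℝ) (f : Cube n → ℤˣ) (z : Cube n) :
    ∏ x, phase θ z x (f x) = Complex.exp ((θ * charSum f z : ℝ) * Complex.I) := by
  simp only [phase, charSum]
  rw [← Complex.exp_sum, ← Finset.sum_mul, Finset.mul_sum, Complex.ofReal_sum]

theorem prod_phase_re {n : ℕ} (θ : ℝ) (f : Cube n → ℤˣ) (z : Cube n) :
    (∏ x, phase θ z x (f x)).re = Real.cos (θ * charSum f z) := by
  rw [prod_phase, Complex.exp_ofReal_mul_I_re]

/-- The values of f are independent, so the sum of exp (i θ S) is a product of 2 ^ n factors, each 2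
cos θ because the character is ±1. -/
theorem sum_cos_charSum {n : ℕ} (θ : ℝ) (z : Cube n) :
    ∑ f : Cube n → ℤˣ, Real.cos (θ * charSum f z) = (2 * Real.cos θ) ^ 2 ^ n := by
  have h := Finset.prod_univ_sum (fun _ : Cube n => (Finset.univ : Finset ℤˣ)) (phase θ z)
  rw [Fintype.piFinset_univ] at h
  simp only [sum_phase, Finset.prod_const, Finset.card_univ, Fintype.card_fun, Fintype.card_bool,
    Fintype.card_fin] at h
  simp only [← prod_phase_re]
  rw [← Complex.re_sum, ← h]
  norm_cast

/-- Minus the θ-derivative of `sum_cos_charSum`. -/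
theorem sum_charSum_mul_sin {n : ℕ} (θ : ℝ) (z : Cube n) :
    ∑ f : Cube n → ℤˣ, charSum f z * Real.sin (θ * charSum f z) =
      2 ^ 2 ^ n * (2 ^ n * Real.cos θ ^ (2 ^ n - 1) * Real.sin θ) := by
  have h1 : HasDerivAt (fun t : ℝ => ∑ f : Cube n → ℤˣ, Real.cos (t * charSum f z))
      (∑ f : Cube n → ℤˣ, -Real.sin (θ * charSum f z) * (1 * charSum f z)) θ :=
    HasDerivAt.fun_sum fun f _ => ((hasDerivAt_id θ).mul_const (charSum f z)).cos
  have h2 := ((Real.hasDerivAt_cos θ).pow (2 ^ n)).const_mul ((2 : ℝ) ^ 2 ^ n)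
  have h3 : (fun t : ℝ => ∑ f : Cube n → ℤˣ, Real.cos (t * charSum f z)) =
      fun t => 2 ^ 2 ^ n * (Real.cos ^ 2 ^ n) t :=
    funext fun t => by rw [sum_cos_charSum, mul_pow, Pi.pow_apply]
  rw [h3] at h1
  have h4 := h1.unique h2
  rw [← neg_inj, ← Finset.sum_neg_distrib]
  convert h4 using 1
  · exact Finset.sum_congr rfl fun f _ => by ring
  · push_cast; ring

/-- The θ-derivative of `sum_charSum_mul_sin`; the factor S² is what the Fourier weight supplies. -/
theorem sum_charSum_sq_mul_cos {n : ℕ} (θ : ℝ) (z : Cube n) :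
    ∑ f : Cube n → ℤˣ, charSum f z ^ 2 * Real.cos (θ * charSum f z) =
      2 ^ 2 ^ n * (2 ^ n * (Real.cos θ ^ 2 ^ n -
        (2 ^ n - 1) * Real.cos θ ^ (2 ^ n - 2) * Real.sin θ ^ 2)) := by
  have h1 : HasDerivAt (fun t : ℝ => ∑ f : Cube n → ℤˣ, charSum f z * Real.sin (t * charSum f z))
      (∑ f : Cube n → ℤˣ, charSum f z * (Real.cos (θ * charSum f z) * (1 * charSum f z))) θ :=
    HasDerivAt.fun_sum fun f _ =>
      (((hasDerivAt_id θ).mul_const (charSum f z)).sin).const_mul (charSum f z)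
  have h2 := ((((Real.hasDerivAt_cos θ).pow (2 ^ n - 1)).mul
    (Real.hasDerivAt_sin θ)).const_mul ((2 : ℝ) ^ n)).const_mul ((2 : ℝ) ^ 2 ^ n)
  have h3 : (fun t : ℝ => ∑ f : Cube n → ℤˣ, charSum f z * Real.sin (t * charSum f z)) =
      fun t => 2 ^ 2 ^ n * (2 ^ n * (Real.cos ^ (2 ^ n - 1) * Real.sin) t) :=
    funext fun t => by rw [sum_charSum_mul_sin, Pi.mul_apply, Pi.pow_apply]; ring
  rw [h3] at h1
  have h4 := h1.unique h2
  have hN : 1 ≤ 2 ^ n := Nat.one_le_two_pow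
  have h5 : Real.cos θ ^ 2 ^ n = Real.cos θ ^ (2 ^ n - 1) * Real.cos θ := by
    rw [← pow_succ, Nat.sub_add_cancel hN]
  convert h4 using 1
  · exact Finset.sum_congr rfl fun f _ => by ring
  · rw [h5, Nat.sub_sub]
    simp only [Pi.pow_apply]
    push_cast [hN]
    ring

/-- The correlation of the Fourier distribution with the cosines of its coefficients. -/
theorem sum_fourierWeight_mul_cos {n : ℕ} (θ : ℝ) :
    ∑ z : Cube n, ∑ f : Cube n → ℤˣ, fourierWeight f z * Real.cos (θ * charSum f z) =
      2 ^ 2 ^ n * (Real.cos θ ^ 2 ^ n -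
        (2 ^ n - 1) * Real.cos θ ^ (2 ^ n - 2) * Real.sin θ ^ 2) := by
  have h : ∀ z : Cube n, ∑ f : Cube n → ℤˣ, fourierWeight f z * Real.cos (θ * charSum f z) =
      2 ^ 2 ^ n * (2 ^ n * (Real.cos θ ^ 2 ^ n -
        (2 ^ n - 1) * Real.cos θ ^ (2 ^ n - 2) * Real.sin θ ^ 2)) / (2 ^ n) ^ 2 := by
    intro z
    rw [← sum_charSum_sq_mul_cos θ z, Finset.sum_div]
    exact Finset.sum_congr rfl fun f _ => by rw [fourierWeight_eq_charSum]; ring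
  simp only [h, Finset.sum_const, Finset.card_univ, Fintype.card_fun, Fintype.card_bool,
    Fintype.card_fin, nsmul_eq_mul]
  push_cast
  field_simp

end CharacterSums

/-! ### Linear lower bound for randomized algorithms -/

section RandomizedLowerBound

theorem fourierDist_toReal {n : ℕ} (f : Cube n → ℤˣ) (y : Cube n) :
    (fourierDist f y).toReal = fourierWeight f y := by
  simp [fourierDist, fourierWeight_nonneg]

theorem PMF.summable_toReal {α : Type*} (p : PMF α) : Summable fun a => (p a).toReal :=
  ENNReal.summable_toReal p.tsum_coe_ne_top

theorem PMF.tsum_toReal {α : Type*} (p : PMF α) : ∑' a, (p a).toReal = 1 := by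
  rw [← ENNReal.tsum_toReal_eq p.apply_ne_top, p.tsum_coe, ENNReal.toReal_one]

theorem RandomizedQueryAlgorithm.outputDist_toReal {n : ℕ} (A : RandomizedQueryAlgorithm n)
    (f : Cube n → ℤˣ) (z : Cube n) :
    (A.outputDist f z).toReal = ∑' T, (A.dist T).toReal * if T.run f = z then 1 else 0 := by
  classical
  rw [RandomizedQueryAlgorithm.outputDist, PMF.map_apply, ENNReal.tsum_toReal_eq]
  · refine tsum_congr fun T => ?_
    by_cases h : T.run f = z
    · simp [h]
    · simp [h, Ne.symm h]
  · intro T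
    split_ifs
    · exact A.dist.apply_ne_top T
    · exact ENNReal.zero_ne_top

/-- Each output z costs at most the contraction factor times the number of f leading to z, and these
numbers add up to 2 ^ 2 ^ n. -/
theorem DecisionTree.neg_sum_cos_le {n : ℕ} (T : DecisionTree n) {θ : ℝ} (hθ : 0 ≤ Real.cos θ) :
    -∑ z, ∑ f : Cube n → ℤˣ, (if T.run f = z then 1 else 0) * Real.cos (θ * charSum f z) ≤
      2 ^ 2 ^ n * Real.cos θ ^ (2 ^ n - T.depth) := by
  have key : ∀ z : Cube n,
      -∑ f : Cube n → ℤˣ, (if T.run f = z then 1 else 0) * Real.cos (θ * charSum f z) ≤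
        Real.cos θ ^ (2 ^ n - T.depth) * ∑ f : Cube n → ℤˣ, if T.run f = z then (1 : ℝ) else 0 := by
    intro z
    have h := T.norm_sum_run_le hθ (Real.cos_le_one θ) (fun x v => (norm_phase θ z x v).le)
      (fun x => by
        rw [sum_phase, norm_mul, Complex.norm_real, Real.norm_of_nonneg hθ, Complex.norm_two]) z
      (fun _ => Finset.univ)
    have h2 := (neg_le_abs _).trans ((Complex.abs_re_le_norm _).trans h)
    rw [Complex.re_sum, Fintype.piFinset_univ, Finset.sum_filter, Finset.sum_filter] at h2
    simpa [prod_phase_re] using h2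
  rw [← Finset.sum_neg_distrib]
  refine (Finset.sum_le_sum fun z _ => key z).trans (le_of_eq ?_)
  rw [← Finset.mul_sum, Finset.sum_comm]
  simp [mul_comm]

theorem RandomizedQueryAlgorithm.neg_sum_outputDist_mul_cos_le {n : ℕ}
    (A : RandomizedQueryAlgorithm n) {θ : ℝ} (hθ : 0 ≤ Real.cos θ) :
    -∑ z, ∑ f : Cube n → ℤˣ, (A.outputDist f z).toReal * Real.cos (θ * charSum f z) ≤
      2 ^ 2 ^ n * Real.cos θ ^ (2 ^ n - A.queries) := by
  have hs : ∀ (z : Cube n) (f : Cube n → ℤˣ), Summable fun T : DecisionTree n =>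
      (A.dist T).toReal * ((if T.run f = z then 1 else 0) * Real.cos (θ * charSum f z)) := by
    intro z f
    refine Summable.of_norm_bounded (PMF.summable_toReal A.dist) fun T => ?_
    rw [norm_mul, Real.norm_of_nonneg ENNReal.toReal_nonneg]
    refine mul_le_of_le_one_right ENNReal.toReal_nonneg ?_
    split_ifs
    · simpa using Real.abs_cos_le_one _
    · simp
  have h1 : ∑ z, ∑ f : Cube n → ℤˣ, (A.outputDist f z).toReal * Real.cos (θ * charSum f z) =
      ∑' T, (A.dist T).toReal * ∑ z, ∑ f : Cube n → ℤˣ,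
        (if T.run f = z then 1 else 0) * Real.cos (θ * charSum f z) := by
    simp only [Finset.mul_sum]
    -- There are infinitely many trees, so exchanging the sums needs summability.
    rw [Summable.tsum_finsetSum fun z _ => summable_sum fun f _ => hs z f]
    refine Finset.sum_congr rfl fun z _ => ?_
    rw [Summable.tsum_finsetSum fun f _ => hs z f]
    refine Finset.sum_congr rfl fun f _ => ?_
    rw [A.outputDist_toReal, ← tsum_mul_right]
    exact tsum_congr fun T => mul_assoc _ _ _
  have hs' : Summable fun T : DecisionTree n => (A.dist T).toReal * ∑ z, ∑ f : Cube n → ℤˣ,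
      (if T.run f = z then 1 else 0) * Real.cos (θ * charSum f z) := by
    simp only [Finset.mul_sum]
    exact summable_sum fun z _ => summable_sum fun f _ => hs z f
  rw [h1, ← tsum_neg]
  calc _ ≤ ∑' T, (A.dist T).toReal * (2 ^ 2 ^ n * Real.cos θ ^ (2 ^ n - A.queries)) := by
        refine hs'.neg.tsum_le_tsum (fun T => ?_) ((PMF.summable_toReal A.dist).mul_right _)
        rw [← mul_neg]
        by_cases hT : T ∈ A.dist.support
        · refine mul_le_mul_of_nonneg_left ((T.neg_sum_cos_le hθ).trans ?_) ENNReal.toReal_nonneg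
          have := A.depth_le T hT
          exact mul_le_mul_of_nonneg_left
            (pow_le_pow_of_le_one hθ (Real.cos_le_one θ) (by omega)) (by positivity)
        · rw [PMF.mem_support_iff, not_not] at hT
          simp [hT]
    _ = _ := by rw [tsum_mul_right, PMF.tsum_toReal, one_mul]

/-- The trade-off between queries and error, for every frequency `θ`. -/
theorem RandomizedQueryAlgorithm.SolvesFourierSampling.cos_bound {n : ℕ}
    {A : RandomizedQueryAlgorithm n} {ε : ℝ} (hA : A.SolvesFourierSampling ε) {θ : ℝ}
    (hθ : 0 ≤ Real.cos θ) :
    (2 ^ n - 1) * Real.cos θ ^ (2 ^ n - 2) * Real.sin θ ^ 2 - Real.cos θ ^ 2 ^ n ≤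
      2 * ε + Real.cos θ ^ (2 ^ n - A.queries) := by
  have h1 := sum_fourierWeight_mul_cos (n := n) θ
  have h2 := A.neg_sum_outputDist_mul_cos_le hθ
  have h3 : ∑ z, ∑ f : Cube n → ℤˣ, (A.outputDist f z).toReal * Real.cos (θ * charSum f z) -
      ∑ z, ∑ f : Cube n → ℤˣ, fourierWeight f z * Real.cos (θ * charSum f z) ≤
        2 ^ 2 ^ n * (2 * ε) := by
    simp only [← Finset.sum_sub_distrib, ← sub_mul]
    rw [Finset.sum_comm]
    calc _ ≤ ∑ f : Cube n → ℤˣ, 2 * ε := by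
          refine Finset.sum_le_sum fun f _ => ?_
          have h := hA f
          simp only [variationDist, fourierDist_toReal] at h
          refine le_trans (Finset.sum_le_sum (g := fun z =>
            |(A.outputDist f z).toReal - fourierWeight f z|) fun z _ => ?_) (by linarith)
          refine (le_abs_self _).trans ?_
          rw [abs_mul]
          exact mul_le_of_le_one_right (abs_nonneg _) (Real.abs_cos_le_one _)
      _ = _ := by simp
  rw [h1] at h3
  have h4 : (0 : ℝ) < 2 ^ 2 ^ n := by positivity
  refine le_of_mul_le_mul_left ?_ h4
  linarith

theorem RandomizedQueryAlgorithm.SolvesFourierSampling.le_queries {n : ℕ} (hn : 7 ≤ n)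
    {A : RandomizedQueryAlgorithm n} (hA : A.SolvesFourierSampling (1 / 40000)) :
    1 / 10 * 2 ^ n ≤ (A.queries : ℝ) := by
  by_contra! ht
  obtain ⟨m, hm⟩ : ∃ m : ℕ, 2 ^ n = 4 * m :=
    ⟨2 ^ (n - 2), by rw [show 4 = 2 ^ 2 by norm_num, ← pow_add]; congr 1; omega⟩
  have hN : 2 ^ 7 ≤ 2 ^ n := Nat.pow_le_pow_right two_pos hn
  have hmR : (2 : ℝ) ^ n = 4 * m := by exact_mod_cast hm
  have hm32 : (32 : ℝ) ≤ m := by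
    have : 32 ≤ m := by omega
    exact_mod_cast this
  have hm0 : (m : ℝ) ≠ 0 := by positivity
  set t := A.queries with ht_def
  rw [hmR] at ht
  have htm : t ≤ 4 * m := by
    have : (t : ℝ) ≤ 4 * m := by linarith
    exact_mod_cast this
  have hinv : (1 : ℝ) / (2 * m) ≤ 1 / 64 := one_div_le_one_div_of_le (by norm_num) (by linarith)
  have hinv0 : (0 : ℝ) < 1 / (2 * m) := by positivity
  -- With N = 4 * m this is cos θ = 1 - 2 / N, so u ^ N is about exp (-2) and (N - 1) sin θ ^ 2 is
  -- about 4.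
  set u : ℝ := 1 - 1 / (2 * m) with hu
  have hu0 : 0 ≤ u := by linarith
  have hu1 : u ≤ 1 := by linarith
  have hcos : Real.cos (Real.arccos u) = u := Real.cos_arccos (by linarith) hu1
  have h := hA.cos_bound (θ := Real.arccos u) (by rw [hcos]; exact hu0)
  rw [Real.sin_sq, hcos, hmR, hm] at h
  have hbern : ∀ k : ℕ, 1 - k * (1 / (2 * m)) ≤ u ^ k := by
    intro k
    have := one_add_mul_le_pow (a := -(1 / (2 * (m : ℝ)))) (by linarith) k
    rw [hu, sub_eq_add_neg 1 (1 / (2 * (m : ℝ)))]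
    linarith
  have hum : 1 / 2 ≤ u ^ m := by
    refine le_trans (le_of_eq ?_) (hbern m)
    field_simp
    norm_num
  have hut : 4 / 5 ≤ u ^ t := by
    refine le_trans ?_ (hbern t)
    have : (t : ℝ) * (1 / (2 * m)) ≤ (1 / 10 * (4 * m)) * (1 / (2 * m)) :=
      mul_le_mul_of_nonneg_right ht.le hinv0.le
    have h2 : (1 / 10 * (4 * (m : ℝ))) * (1 / (2 * m)) = 1 / 5 := by field_simp; norm_num
    linarith
  have huN : 1 / 16 ≤ u ^ (4 * m) := by
    rw [mul_comm, pow_mul]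
    calc (1 / 16 : ℝ) = (1 / 2) ^ 4 := by norm_num
      _ ≤ _ := pow_le_pow_left₀ (by norm_num) hum 4
  have hsplit : u ^ (4 * m) = u ^ (4 * m - t) * u ^ t := by
    rw [← pow_add, Nat.sub_add_cancel htm]
  have hle : u ^ (4 * m) ≤ u ^ (4 * m - 2) := pow_le_pow_of_le_one hu0 hu1 (by omega)
  have hle' : u ^ (4 * m) ≤ u ^ (4 * m - t) := pow_le_pow_of_le_one hu0 hu1 (by omega)
  have hcoef : (3.9 : ℝ) ≤ (4 * m - 1) * (1 - u ^ 2) := by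
    have : (4 * (m : ℝ) - 1) * (1 - u ^ 2) = 4 - 4 * (1 / (2 * m)) + (1 / (2 * m)) ^ 2 := by
      rw [hu]; field_simp; ring
    rw [this]
    nlinarith
  have h6 : 3.9 * u ^ (4 * m) ≤ (4 * m - 1) * u ^ (4 * m - 2) * (1 - u ^ 2) := by
    calc 3.9 * u ^ (4 * m) ≤ ((4 * m - 1) * (1 - u ^ 2)) * u ^ (4 * m - 2) :=
          mul_le_mul hcoef hle (by positivity) (by linarith)
      _ = _ := by ring
  have h7 : u ^ (4 * m - t) * (4 / 5) ≤ u ^ (4 * m) := by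
    rw [hsplit]
    exact mul_le_mul_of_nonneg_left hut (by positivity)
  -- Together: 2.9 * u ^ N ≤ 1 / 20000 + 1.25 * u ^ N, contradicting u ^ N ≥ 1 / 16.
  linarith

end RandomizedLowerBound

/-! ### Exact one-query quantum algorithm -/

section QuantumUpperBound

/-- Hadamard gates on the query register, and a bit flip of the control qubit. -/
noncomputable def hadamardFlip (n : ℕ) : Matrix (QueryBasis n 0) (QueryBasis n 0) ℂ :=
  fun s s' => if s.2.1 = s'.2.1 then 0 else ((cubeChar s.1 s'.1 / √(2 ^ n) : ℝ) : ℂ)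

theorem hadamardFlip_mulVec {n : ℕ} (ψ : QueryBasis n 0 → ℂ) (y : Cube n) (b : Bool)
    (w : Cube 0) :
    (hadamardFlip n).mulVec ψ (y, b, w) =
      ∑ x, ((cubeChar y x / √(2 ^ n) : ℝ) : ℂ) * ψ (x, !b, w) := by
  simp only [Matrix.mulVec, dotProduct, hadamardFlip, Fintype.sum_prod_type]
  refine Finset.sum_congr rfl fun x _ => ?_
  rw [Fintype.sum_bool, Fintype.sum_unique, Fintype.sum_unique, ← Unique.eq_default w]
  cases b <;> simp only [Bool.not_false, Bool.not_true, Bool.false_eq_true, Bool.true_eq_false,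
    if_true, if_false, zero_mul, zero_add, add_zero]

theorem hadamardFlip_mem_unitaryGroup (n : ℕ) :
    hadamardFlip n ∈ Matrix.unitaryGroup (QueryBasis n 0) ℂ := by
  rw [Matrix.mem_unitaryGroup_iff]
  ext ⟨x, b, w⟩ ⟨x', b', w'⟩
  obtain rfl := Subsingleton.elim w w'
  have hmul : (hadamardFlip n * star (hadamardFlip n)) (x, b, w) (x', b', w) =
      (hadamardFlip n).mulVec (fun s => star (hadamardFlip n (x', b', w) s)) (x, b, w) := rfl
  rw [hmul, hadamardFlip_mulVec]
  by_cases hb : b = b'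
  · subst hb
    have h1 : ∀ y : Cube n, ((cubeChar x y / √(2 ^ n) : ℝ) : ℂ) *
        star (hadamardFlip n (x', b, w) (y, !b, w)) =
        ((cubeChar x y * cubeChar x' y / 2 ^ n : ℝ) : ℂ) := by
      intro y
      have h2 : hadamardFlip n (x', b, w) (y, !b, w) = ((cubeChar x' y / √(2 ^ n) : ℝ) : ℂ) := by
        simp [hadamardFlip]
      rw [h2, Complex.star_def, Complex.conj_ofReal, ← Complex.ofReal_mul, div_mul_div_comm,
        Real.mul_self_sqrt (by positivity)]
    rw [Finset.sum_congr rfl fun y _ => h1 y, ← Complex.ofReal_sum, ← Finset.sum_div,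
      sum_cubeChar_mul_cubeChar, Matrix.one_apply]
    by_cases hx : x = x' <;> simp [hx]
  · have hb' : b' = !b := by cases b <;> cases b' <;> simp_all
    subst hb'
    simp [hadamardFlip]

/-- The one-query algorithm for Fourier Sampling. -/
noncomputable def fourierSampler (n : ℕ) : QuantumQueryAlgorithm n where
  queries := 1
  workspace := 0
  -- The first use turns the control on, so that the query acts; the second turns it off again.
  U := fun _ => ⟨hadamardFlip n, hadamardFlip_mem_unitaryGroup n⟩
  out := fun s => s.1

theorem fourierSampler_state_zero {n : ℕ} (f : Cube n → ℤˣ) :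
    (fourierSampler n).state f 0 =
      fun s : QueryBasis n 0 => if s.2.1 then ((1 / √(2 ^ n) : ℝ) : ℂ) else 0 := by
  have h : (fourierSampler n).state f 0 = (hadamardFlip n).mulVec
      (Pi.single ((fun _ => false, false, fun _ => false) : QueryBasis n 0) 1) := rfl
  rw [h, Matrix.mulVec_single_one]
  funext ⟨x, b, w⟩
  cases b <;> simp [Matrix.col, hadamardFlip, cubeChar]

theorem fourierSampler_state_one {n : ℕ} (f : Cube n → ℤˣ) :
    (fourierSampler n).state f 1 =
      fun s : QueryBasis n 0 => if s.2.1 then 0 else ((charSum f s.1 / 2 ^ n : ℝ) : ℂ) := by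
  have h : (fourierSampler n).state f 1 = (hadamardFlip n).mulVec (quantumQuery f
      fun s : QueryBasis n 0 => if s.2.1 then ((1 / √(2 ^ n) : ℝ) : ℂ) else 0) :=
    congrArg (fun ψ : QueryBasis n 0 → ℂ => (hadamardFlip n).mulVec (quantumQuery f ψ))
      (fourierSampler_state_zero f)
  rw [h]
  funext ⟨y, b, w⟩
  rw [hadamardFlip_mulVec]
  cases b
  · simp only [quantumQuery, Bool.not_false, if_true, Bool.false_eq_true, if_false, charSum]
    rw [Finset.sum_div, Complex.ofReal_sum]
    refine Finset.sum_congr rfl fun x _ => ?_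
    rw [← Complex.ofReal_intCast, ← Complex.ofReal_mul, ← Complex.ofReal_mul, cubeChar_comm y x,
      mul_one_div, div_mul_div_comm, Real.mul_self_sqrt (by positivity), mul_comm]
  · simp [quantumQuery]

theorem fourierSampler_outputProb {n : ℕ} (f : Cube n → ℤˣ) (y : Cube n) :
    (fourierSampler n).outputProb f y = fourierWeight f y := by
  have h : (fourierSampler n).outputProb f y = ∑ s : QueryBasis n 0, if s.1 = y then
      ‖(if s.2.1 then 0 else ((charSum f s.1 / 2 ^ n : ℝ) : ℂ))‖ ^ 2 else 0 :=
    congrArg (fun ψ : QueryBasis n 0 → ℂ => ∑ s, if s.1 = y then ‖ψ s‖ ^ 2 else 0)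
      (fourierSampler_state_one f)
  rw [h, Fintype.sum_prod_type, Finset.sum_eq_single y]
  · rw [Fintype.sum_prod_type, Fintype.sum_bool, Fintype.sum_unique, Fintype.sum_unique]
    simp only [if_true, Bool.false_eq_true, if_false, Complex.norm_real, Real.norm_eq_abs, sq_abs,
      norm_zero]
    rw [zero_pow two_ne_zero, zero_add]
    rfl
  · intro x _ hx
    simp [hx]
  · simp

end QuantumUpperBound

/-- Linear randomized lower bound for Fourier Sampling with error `1/40000`; an exact one-query
quantum algorithm; and, in particular, `O(2ⁿ/n)` randomized queries do not suffice. -/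
theorem mainTheorem2 :
    (∃ c : ℝ, 0 < c ∧ ∃ n₀ : ℕ, ∀ n : ℕ, n₀ ≤ n → ∀ A : RandomizedQueryAlgorithm n,
      A.SolvesFourierSampling (1 / 40000) → c * 2 ^ n ≤ (A.queries : ℝ)) ∧
    (∀ n : ℕ, ∃ Q : QuantumQueryAlgorithm n, Q.queries = 1 ∧
      ∀ (f : Cube n → ℤˣ) (y : Cube n), Q.outputProb f y = (fourierDist f y).toReal) ∧
    (∀ C : ℝ, ∃ n₀ : ℕ, ∀ n : ℕ, n₀ ≤ n → ¬ ∃ A : RandomizedQueryAlgorithm n,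
      A.SolvesFourierSampling (1 / 40000) ∧ (A.queries : ℝ) ≤ C * (2 ^ n / n)) := by
  refine ⟨⟨1 / 10, by norm_num, 7, fun n hn A hA => hA.le_queries hn⟩,
    fun n => ⟨fourierSampler n, rfl, fun f y => ?_⟩, fun C => ?_⟩
  · rw [fourierSampler_outputProb, fourierDist_toReal]
  · obtain ⟨k, hk⟩ := exists_nat_gt (10 * C)
    refine ⟨max 7 k, fun n hn => ?_⟩
    rintro ⟨A, hA, hq⟩
    have h1 := hA.le_queries ((le_max_left _ _).trans hn)
    have h2 : (k : ℝ) ≤ n := by exact_mod_cast (le_max_right _ _).trans hn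
    have h3 : 7 ≤ n := (le_max_left _ _).trans hn
    have hn0 : (0 : ℝ) < n := by exact_mod_cast (by omega : 0 < n)
    have h4 : (0 : ℝ) < 2 ^ n := by positivity
    -- This is 10 * C < n, which the choice of k ensures.
    have h5 : C * (2 ^ n / n) < 1 / 10 * 2 ^ n := by
      rw [mul_div_assoc', div_lt_iff₀ hn0]
      nlinarith
    linarith
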